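/- Let $k$ be a field with $\operatorname{char} k\neq 2$, let $n\ge 0$, let $a_1,\dots,a_n,c_1,\dots,c_n\in k\setminus\{0\}$, and let $K=k(\sqrt{a_1},\dots,\sqrt{a_n})$, where $\sqrt{a_i}\in K$ is a fixed square root of $a_i$. Let $K(x_1,\dots,x_n)$ be the rational function field in $n$ variables over $K$, and let $\sigma_1,\dots,\sigma_n$ be $k$-automorphisms of $K(x_1,\dots,x_n)$ such that, for all $1\le i,j\le n$, $$\sigma_i(\sqrt{a_j})=\begin{cases}-\sqrt{a_j}& i=j,\\ \sqrt{a_j}& i\neq j,\end{cases}\qquad \sigma_i(x_j)=\begin{cases}c_j/x_j& i=j,\\ x_j& i\neq j.\end{cases}$$ Let $L=K(x_1,\dots,x_n)^{\langle\sigma_1,\dots,\sigma_n\rangle}$ be the fixed field. For $a,b\in k\setminus\{0\}$ let $(a,b)_{2,k}\in\operatorname{Br}(k)$ denote the class of the quaternion algebra over $k$ generated by $u,v$ with $u^2=a$, $v^2=b$, $uv=-vu$. A field extension $F/k$ is called $k$-rational if it is $k$-isomorphic to the quotient field of a polynomial ring $k[y_1,\dots,y_m]$ for some $m\ge 0$;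 stably $k$-rational if for some $m\ge 0$ the rational function field $F(y_1,\dots,y_m)$ is $k$-rational; and $k$-unirational if it is $k$-isomorphic to a subfield of a $k$-rational field. Then $L=k(s_1,\dots,s_n,t_1,\dots,t_n)$ for some elements $s_i,t_i$ satisfying $$s_i^2-a_it_i^2=c_i\qquad(1\le i\le n),$$ and the following statements are equivalent: (i) $L$ is $k$-rational; (ii) $L$ is stably $k$-rational; (iii) $L$ is $k$-unirational; (iv) the affine variety in $\mathbb A^{2n}_k$ with coordinates $(S_1,T_1,\dots,S_n,T_n)$ defined by $S_i^2-a_iT_i^2=c_i$ $(1\le i\le n)$ has a $k$-rational point; (v) $(a_i,c_i)_{2,k}=0$ in $\operatorname{Br}(k)$ for $i=1,\dots,n$. -/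

import Mathlib

universe u v

/-! ### Rationality notions for a field extension `L` of `k` -/

/-- `L` is `k`-rational: it is `k`-isomorphic to the quotient field of a polynomial ring
`k[X₁, …, X_m]`. -/
def IsRationalOver (k : Type u) (L : Type v) [Field k] [Field L] [Algebra k L] : Prop :=
  ∃ m : ℕ, Nonempty (L ≃ₐ[k] FractionRing (MvPolynomial (Fin m) k))

/-- `L` is stably `k`-rational: `L(y₁, …, y_m)` is `k`-rational for some `m` and some
`y₁, …, y_m` algebraically independent over `L`. -/
def IsStablyRationalOver (k : Type u) (L : Type v) [Field k] [Field L] [Algebra k L] : Prop :=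
  ∃ m : ℕ, IsRationalOver k (FractionRing (MvPolynomial (Fin m) L))

/-- `L` is `k`-unirational: it is `k`-isomorphic to a subfield of a `k`-rational field. -/
def IsUnirationalOver (k : Type u) (L : Type v) [Field k] [Field L] [Algebra k L] : Prop :=
  ∃ m : ℕ, Nonempty (L →ₐ[k] FractionRing (MvPolynomial (Fin m) k))

/-! ### The norm residue symbol of degree two

In Mathlib `ℍ[k, a, 0, b]` is `QuaternionAlgebra k a 0 b`, the `k`-algebra with basis
`1, i, j, ij` and `i² = a`, `j² = b`, `ij = -ji`. -/

/-- The quaternion algebra is central over `k` when `char k ≠ 2` and `a, b` are nonzero. -/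
theorem quaternionAlgebra_isCentral {k : Type u} [Field k] (hk : ringChar k ≠ 2) (a b : kˣ) :
    Algebra.IsCentral k (QuaternionAlgebra k (a : k) 0 (b : k)) := by
  have h2 : (2 : k) ≠ 0 := Ring.two_ne_zero hk
  have ha : (a : k) ≠ 0 := a.ne_zero
  have hself : ∀ t : k, t = -t → t = 0 := by
    intro t ht
    have h : (2 : k) * t = 0 := by linear_combination ht
    exact (mul_eq_zero.mp h).resolve_left h2
  refine ⟨fun z hz => ?_⟩
  rw [Subalgebra.mem_center_iff] at hz
  have hi := hz ⟨0, 1, 0, 0⟩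
  have hj := hz ⟨0, 0, 1, 0⟩
  have e1 := congrArg QuaternionAlgebra.imJ hi
  have e2 := congrArg QuaternionAlgebra.imK hi
  have e3 := congrArg QuaternionAlgebra.imK hj
  simp at e1 e2 e3
  rw [Algebra.mem_bot]
  refine ⟨z.re, ?_⟩
  have f1 : z.imI = 0 := hself _ (by linear_combination -e3)
  have f2 : z.imJ = 0 := hself _ (by linear_combination e2)
  have f3 : z.imK = 0 := by
    have h := hself ((a : k) * z.imK) (by linear_combination e1)
    exact (mul_eq_zero.mp h).resolve_left ha
  ext <;> simp [QuaternionAlgebra.algebraMap_eq, f1, f2, f3]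

/-- The quaternion algebra is simple when `char k ≠ 2` and `a, b` are nonzero. -/
theorem quaternionAlgebra_isSimpleRing {k : Type u} [Field k] (hk : ringChar k ≠ 2) (a b : kˣ) :
    IsSimpleRing (QuaternionAlgebra k (a : k) 0 (b : k)) := by
  have h2 : (2 : k) ≠ 0 := Ring.two_ne_zero hk
  have ha : (a : k) ≠ 0 := a.ne_zero
  have hb : (b : k) ≠ 0 := b.ne_zero
  have key : ∀ (I : TwoSidedIdeal (QuaternionAlgebra k (a : k) 0 (b : k)))
      (x : QuaternionAlgebra k (a : k) 0 (b : k)), x ∈ I → x.re ≠ 0 → I = ⊤ := by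
    intro I x hx hre
    rw [← TwoSidedIdeal.one_mem_iff]
    have h1 := I.mul_mem_left ⟨(4 * x.re)⁻¹, 0, 0, 0⟩ _ hx
    have hi := I.mul_mem_left ⟨0, (4 * x.re)⁻¹ * (a : k)⁻¹, 0, 0⟩ _
      (I.mul_mem_right _ ⟨0, 1, 0, 0⟩ hx)
    have hj := I.mul_mem_left ⟨0, 0, (4 * x.re)⁻¹ * (b : k)⁻¹, 0⟩ _
      (I.mul_mem_right _ ⟨0, 0, 1, 0⟩ hx)
    have hl := I.mul_mem_left ⟨0, 0, 0, -((4 * x.re)⁻¹ * (a : k)⁻¹ * (b : k)⁻¹)⟩ _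
      (I.mul_mem_right _ ⟨0, 0, 0, 1⟩ hx)
    have h := I.add_mem (I.add_mem h1 hi) (I.add_mem hj hl)
    convert h using 1
    have h4 : (4 : k) ≠ 0 := by
      have h22 := mul_ne_zero h2 h2
      norm_num at h22
      exact h22
    ext <;> simp <;> field_simp <;> ring
  have : Nontrivial (QuaternionAlgebra k (a : k) 0 (b : k)) :=
    ⟨⟨0, 1, fun h => by simpa using congrArg QuaternionAlgebra.re h⟩⟩
  refine IsSimpleRing.of_eq_bot_or_eq_top fun I => ?_
  by_cases htop : I = ⊤
  · exact Or.inr htop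
  refine Or.inl (le_antisymm (fun x hx => ?_) bot_le)
  have hre : ∀ y ∈ I, QuaternionAlgebra.re y = 0 := fun y hy => by
    by_contra hne
    exact htop (key I y hy hne)
  have e0 := hre x hx
  have e1 := hre _ (I.mul_mem_right x ⟨0, 1, 0, 0⟩ hx)
  have e2 := hre _ (I.mul_mem_right x ⟨0, 0, 1, 0⟩ hx)
  have e3 := hre _ (I.mul_mem_right x ⟨0, 0, 0, 1⟩ hx)
  simp [ha, hb] at e1 e2 e3
  rw [TwoSidedIdeal.mem_bot]
  ext <;> simp [e0, e1, e2, e3]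

/-- The quaternion algebra `⊕ k uⁱ vʲ` with `u² = a`, `v² = b`, `uv = -vu`, as a
finite-dimensional central simple `k`-algebra. -/
def quaternionCSA {k : Type u} [Field k] (hk : ringChar k ≠ 2) (a b : kˣ) : CSA.{u, u} k where
  toAlgCat := AlgCat.of k (QuaternionAlgebra k (a : k) 0 (b : k))
  isCentral := quaternionAlgebra_isCentral hk a b
  isSimple := quaternionAlgebra_isSimpleRing hk a b
  fin_dim := inferInstanceAs (Module.Finite k (QuaternionAlgebra k (a : k) 0 (b : k)))

/-- The field `k` as a central simple algebra over itself. -/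
def trivialCSA (k : Type u) [Field k] : CSA.{u, u} k where
  toAlgCat := AlgCat.of k k
  isCentral := inferInstanceAs (Algebra.IsCentral k k)
  isSimple := inferInstanceAs (IsSimpleRing k)
  fin_dim := inferInstanceAs (Module.Finite k k)

/-- The neutral element of `Br(k)` (written additively): the class of `k`. -/
instance brauerGroupZero (k : Type u) [Field k] : Zero (BrauerGroup.{u, u} k) :=
  ⟨Quotient.mk (Brauer.CSA_Setoid k) (trivialCSA k)⟩

/-- The norm residue symbol `(a, b)_{2,k}` of degree two: the class of the quaternion algebra in
`Br(k)`. -/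
def normResidueSymbolTwo {k : Type u} [Field k] (hk : ringChar k ≠ 2) (a b : kˣ) :
    BrauerGroup.{u, u} k :=
  Quotient.mk (Brauer.CSA_Setoid k) (quaternionCSA hk a b)

/-! ### The rational function field -/

/-- The rational function field `K(x₁, …, x_n)`. -/
abbrev RatFunField (n : ℕ) (K : Type v) [Field K] : Type v :=
  FractionRing (MvPolynomial (Fin n) K)

/-- The `i`-th variable `x_i` of `K(x₁, …, x_n)`. -/
noncomputable def ratFunVar {n : ℕ} (K : Type v) [Field K] (i : Fin n) : RatFunField n K :=
  algebraMap (MvPolynomial (Fin n) K) (RatFunField n K) (MvPolynomial.X i)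

/-!
Write `E = K(x₁, …, xₙ)`, let `L` be the fixed field, and put `sᵢ = (xᵢ + cᵢ/xᵢ)/2`,
`tᵢ = (xᵢ - cᵢ/xᵢ)/(2√aᵢ)`. These are invariant points of the conics `s² - aᵢ t² = cᵢ`, and
`xᵢ = sᵢ + √aᵢ tᵢ`, so `E` is obtained from `k(s, t)` by adjoining the `√aᵢ`. Any automorphism of `E`
over `k(s, t)` changes the signs of some of the `√aᵢ` and is therefore a product of the `σᵢ`; by Galois
theory `k(s, t)` is all of `L` (`fixedField_closure_eq`).

Rationality implies stable rationality and that implies unirationality. If `L` embeds in `k(y₁, …, y_m)`,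
the images of the `sᵢ, tᵢ` are points of the conics over a purely transcendental extension of `k`, and
such points specialise to `k` (`exists_sq_sub_mul_sq_eq_of_fractionRing`). Conversely, projection of each
conic from a `k`-point replaces `xᵢ` by an invariant Möbius transform `wᵢ` of it (`conicParameter`). The
same Galois argument gives `L = k(w₁, …, wₙ)`, and the `wᵢ` are algebraically independent because `E`
is algebraic over `L` and has transcendence degree `n` over `k`.

The conic `p² - a q² = c` has a `k`-point exactly when the quaternion algebra `(a, c)` is trivial in
the Brauer group. A point yields an explicit splitting. If there is none, the norm form is anisotropic and
the quaternion algebra is a division algebra `D`; then `Mₙ(D) ≃ M_{2n}(k)` is impossible, as the two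
rings have different maximal nilpotency indices (`Matrix.le_of_ringEquiv`).
-/

/-! ### Points of conics over purely transcendental extensions -/

theorem exists_sq_sub_mul_sq_eq_of_finite {k : Type*} [Field k] [Finite k] (hk : ringChar k ≠ 2)
    {a : k} (ha : a ≠ 0) (c : k) : ∃ p q : k, p ^ 2 - a * q ^ 2 = c := by
  have := Fintype.ofFinite k
  have hcard : Fintype.card k % 2 = 1 := FiniteField.odd_card_of_char_ne_two hk
  obtain ⟨p, q, h⟩ := FiniteField.exists_root_sum_quadratic
    (f := (.X ^ 2 - .C c : Polynomial k)) (g := .C (-a) * .X ^ 2)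
    (Polynomial.degree_X_pow_sub_C two_pos c)
    (Polynomial.degree_C_mul_X_pow 2 (neg_ne_zero.mpr ha)) hcard
  refine ⟨p, q, ?_⟩
  simp at h
  linear_combination h

/-- A conic `p² - a q² = c` with a point over a purely transcendental extension of `k` has one over
`k`. Over an infinite field a point is specialised where its denominators do not vanish; over a finite field,
where no such specialisation need exist, the conic has a point anyway. -/
theorem exists_sq_sub_mul_sq_eq_of_fractionRing {k : Type*} [Field k] (hk : ringChar k ≠ 2)
    {ι : Type*} {a c : k} (ha : a ≠ 0) {s t : FractionRing (MvPolynomial ι k)}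
    (h : s ^ 2 - algebraMap k _ a * t ^ 2 = algebraMap k _ c) :
    ∃ p q : k, p ^ 2 - a * q ^ 2 = c := by
  cases finite_or_infinite k
  · exact exists_sq_sub_mul_sq_eq_of_finite hk ha c
  obtain ⟨S, U, hU, rfl⟩ := IsFractionRing.div_surjective (MvPolynomial ι k) s
  obtain ⟨T, V, hV, rfl⟩ := IsFractionRing.div_surjective (MvPolynomial ι k) t
  have hU0 := nonZeroDivisors.ne_zero hU
  have hV0 := nonZeroDivisors.ne_zero hV
  obtain ⟨x, hx⟩ : ∃ x : ι → k, MvPolynomial.eval x (U * V) ≠ 0 := by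
    by_contra! hx
    exact mul_ne_zero hU0 hV0 (MvPolynomial.funext fun x => by simpa using hx x)
  rw [map_mul, mul_ne_zero_iff] at hx
  have hpoly : (S * V) ^ 2 - .C a * (T * U) ^ 2 = .C c * (U * V) ^ 2 := by
    apply IsFractionRing.injective (MvPolynomial ι k) (FractionRing (MvPolynomial ι k))
    have hU' : algebraMap (MvPolynomial ι k) (FractionRing (MvPolynomial ι k)) U ≠ 0 := by
      simpa using hU0
    have hV' : algebraMap (MvPolynomial ι k) (FractionRing (MvPolynomial ι k)) V ≠ 0 := by
      simpa using hV0
    simp only [IsScalarTower.algebraMap_apply k (MvPolynomial ι k)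
      (FractionRing (MvPolynomial ι k)), MvPolynomial.algebraMap_eq] at h
    field_simp at h
    simp only [map_sub, map_mul, map_pow]
    linear_combination h
  have he := congrArg (MvPolynomial.eval x) hpoly
  simp only [map_sub, map_mul, map_pow, MvPolynomial.eval_C] at he
  obtain ⟨hx1, hx2⟩ := hx
  refine ⟨MvPolynomial.eval x S / MvPolynomial.eval x U,
    MvPolynomial.eval x T / MvPolynomial.eval x V, ?_⟩
  field_simp
  linear_combination he

/-! ### Splitting of quaternion algebras -/

open scoped Matrix in
/-- The action on row vectors is used, since it is linear for left multiplication by `D` even when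
`D` is noncommutative. -/
theorem Matrix.pow_eq_zero_of_isNilpotent {D : Type*} [DivisionRing D] {n : ℕ}
    {M : Matrix (Fin n) (Fin n) D} (hM : IsNilpotent M) : M ^ n = 0 := by
  let f : Module.End D (Fin n → D) := Matrix.toLinearMapRight' M
  have hf : ∀ (p : ℕ) (v : Fin n → D), (f ^ p) v = v ᵥ* M ^ p := by
    intro p
    induction p with
    | zero => simp
    | succ p ih =>
      intro v
      rw [pow_succ', Module.End.mul_apply, ih, pow_succ, ← Matrix.vecMul_vecMul]
      rfl
  obtain ⟨N, hN⟩ := hM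
  have hle := Module.End.ker_pow_le_ker_pow_finrank f N
  rw [Module.finrank_fin_fun] at hle
  ext i j
  have : Pi.single i 1 ∈ LinearMap.ker (f ^ n) := hle (by simp [hf, hN])
  rw [LinearMap.mem_ker, hf] at this
  simpa using congrFun this j

/-- The nilpotent Jordan block of size `m`, with ones just above the diagonal. -/
def Matrix.shift (R : Type*) [Ring R] (m : ℕ) : Matrix (Fin m) (Fin m) R :=
  .of fun i j => if (j : ℕ) = i + 1 then 1 else 0

theorem Matrix.shift_pow (R : Type*) [Ring R] (m p : ℕ) (i j : Fin m) :
    (Matrix.shift R m ^ p) i j = if (j : ℕ) = i + p then 1 else 0 := by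
  induction p generalizing j with
  | zero => simp [Matrix.one_apply, Fin.ext_iff, eq_comm]
  | succ p ih =>
    rw [pow_succ, Matrix.mul_apply]
    simp only [ih]
    simp only [Matrix.shift, Matrix.of_apply]
    by_cases hj : (j : ℕ) = i + (p + 1)
    · rw [Finset.sum_eq_single ⟨i + p, by omega⟩]
      · simp [hj, add_assoc]
      · intro b _ hb
        rw [if_neg (fun h => hb (Fin.ext h)), zero_mul]
      · simp
    · rw [if_neg hj]
      refine Finset.sum_eq_zero fun b _ => ?_
      split_ifs <;> simp
      omega

/-- Nilpotent matrices of size `n` over a division ring have nilpotency index at most `n`, while the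
Jordan block of size `m` has index exactly `m`; so a ring isomorphism bounds `m` by `n`. -/
theorem Matrix.le_of_ringEquiv {D R : Type*} [DivisionRing D] [Ring R] [Nontrivial R] {n m : ℕ}
    (e : Matrix (Fin n) (Fin n) D ≃+* Matrix (Fin m) (Fin m) R) : m ≤ n := by
  by_contra! hlt
  have hnil : IsNilpotent (e.symm (shift R m)) := by
    refine IsNilpotent.map (f := e.symm) ⟨m, ?_⟩
    ext i j
    rw [shift_pow, if_neg (by omega), Matrix.zero_apply]
  have h := pow_eq_zero_of_isNilpotent hnil
  -- the entry of `shift ^ n` at `(0, n)` is `1`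
  rw [← map_pow, map_eq_zero_iff _ e.symm.injective] at h
  have h' := congrFun (congrFun h ⟨0, by omega⟩) ⟨n, hlt⟩
  simp [shift_pow] at h'

theorem exists_sq_sub_mul_sq_eq_of_isSquare {k : Type*} [Field k] (hk : ringChar k ≠ 2)
    {a : k} (ha : a ≠ 0) (hsq : IsSquare a) (c : k) : ∃ p q : k, p ^ 2 - a * q ^ 2 = c := by
  obtain ⟨r, rfl⟩ := hsq
  have h2 : (2 : k) ≠ 0 := Ring.two_ne_zero hk
  have hr : r ≠ 0 := left_ne_zero_of_mul ha
  refine ⟨(c + 1) / 2, (c - 1) / (2 * r), ?_⟩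
  field_simp
  ring

/-- If `c` is not of the form `p² - a q²`, the norm form of the quaternion algebra is anisotropic, so
that every nonzero quaternion is inverted by its conjugate divided by its norm. -/
theorem QuaternionAlgebra.isUnit_of_ne_zero {k : Type*} [Field k] (hk : ringChar k ≠ 2) {a c : k}
    (ha : a ≠ 0) (hc : ¬ ∃ p q : k, p ^ 2 - a * q ^ 2 = c) {x : QuaternionAlgebra k a 0 c}
    (hx : x ≠ 0) : IsUnit x := by
  -- `a` is not a square, since otherwise every `c` would be of this form
  have hsq : ∀ u v : k, u ^ 2 - a * v ^ 2 = 0 → u = 0 ∧ v = 0 := by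
    intro u v huv
    have hv : v = 0 := by
      by_contra hv
      refine hc (exists_sq_sub_mul_sq_eq_of_isSquare hk ha ⟨u / v, ?_⟩ c)
      field_simp
      linear_combination -huv
    subst hv
    simpa using huv
  set N : k := x.re ^ 2 - a * x.imI ^ 2 - c * (x.imJ ^ 2 - a * x.imK ^ 2) with hN
  have hN0 : N ≠ 0 := by
    intro h0
    by_cases hv : x.imJ ^ 2 - a * x.imK ^ 2 = 0
    · rw [hv, mul_zero, sub_zero] at hN
      obtain ⟨h1, h2⟩ := hsq _ _ (hN.symm.trans h0)
      obtain ⟨h3, h4⟩ := hsq _ _ hv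
      exact hx (by ext <;> simp [*])
    · -- then `c` is a quotient of norms from `k(√a)`, hence the norm of
      -- `(re + imI √a) / (imJ + imK √a)`
      refine hc ⟨(x.re * x.imJ - a * x.imI * x.imK) / (x.imJ ^ 2 - a * x.imK ^ 2),
        (x.imI * x.imJ - x.re * x.imK) / (x.imJ ^ 2 - a * x.imK ^ 2), ?_⟩
      rw [h0] at hN
      field_simp
      linear_combination (-(x.imJ ^ 2 - a * x.imK ^ 2)) * hN
  have hstar : star x = ⟨x.re, -x.imI, -x.imJ, -x.imK⟩ := by ext <;> simp
  have h1 : x * star x = N • 1 := by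
    rw [hstar]; ext <;> simp [hN] <;> ring
  have h2 : star x * x = N • 1 := by
    rw [hstar]; ext <;> simp [hN] <;> ring
  refine ⟨⟨x, N⁻¹ • star x, ?_, ?_⟩, rfl⟩
  · rw [mul_smul_comm, h1, smul_smul, inv_mul_cancel₀ hN0, one_smul]
  · rw [smul_mul_assoc, h2, smul_smul, inv_mul_cancel₀ hN0, one_smul]

/-- If `c` were not of the form `p² - a q²`, the quaternion algebra would be a division algebra `D`
with `Mₙ(D) ≃ M_m(k)`. Comparing dimensions gives `m = 2n`, while `Matrix.le_of_ringEquiv` gives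
`m ≤ n`. -/
theorem exists_of_normResidueSymbolTwo_eq_zero {k : Type u} [Field k] (hk : ringChar k ≠ 2)
    {a c : kˣ} (h : normResidueSymbolTwo hk a c = 0) :
    ∃ p q : k, p ^ 2 - (a : k) * q ^ 2 = c := by
  by_contra hc
  obtain ⟨n, m, hn, hm, ⟨e⟩⟩ := Quotient.exact h
  change Matrix (Fin n) (Fin n) (QuaternionAlgebra k (a : k) 0 (c : k)) ≃ₐ[k]
    Matrix (Fin m) (Fin m) k at e
  have hrank := e.toLinearEquiv.finrank_eq
  simp only [Module.finrank_matrix, Fintype.card_fin, QuaternionAlgebra.finrank_eq_four,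
    Module.finrank_self, mul_one] at hrank
  have hdiv : ∀ x : QuaternionAlgebra k (a : k) 0 (c : k), IsUnit x ∨ x = 0 := fun x =>
    or_iff_not_imp_right.mpr fun hx => QuaternionAlgebra.isUnit_of_ne_zero hk a.ne_zero hc hx
  have : Nontrivial (QuaternionAlgebra k (a : k) 0 (c : k)) :=
    ⟨⟨0, 1, fun h => by simpa using congrArg QuaternionAlgebra.re h⟩⟩
  let _ := DivisionRing.ofIsUnitOrEqZero hdiv
  have hle : m ≤ n := Matrix.le_of_ringEquiv e.toRingEquiv
  nlinarith [Nat.mul_le_mul hle hle, Nat.mul_pos (Nat.pos_of_ne_zero hn) (Nat.pos_of_ne_zero hn)]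

/-- A point `(p, q)` of the conic gives an explicit isomorphism of the quaternion algebra with the
`2 × 2` matrices; it is injective because the quaternion algebra is simple. -/
theorem normResidueSymbolTwo_eq_zero {k : Type u} [Field k] (hk : ringChar k ≠ 2)
    {a c : kˣ} {p q : k} (h : p ^ 2 - (a : k) * q ^ 2 = c) : normResidueSymbolTwo hk a c = 0 := by
  let B : QuaternionAlgebra.Basis (Matrix (Fin 2) (Fin 2) k) (a : k) 0 (c : k) :=
    { i := !![0, a; 1, 0]
      j := !![p, -a * q; q, -p]
      k := !![a * q, -a * p; p, -a * q]
      i_mul_i := by ext i j; fin_cases i <;> fin_cases j <;> simp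
      j_mul_j := by
        rw [← h]
        ext i j; fin_cases i <;> fin_cases j <;> simp <;> ring
      i_mul_j := by ext i j; fin_cases i <;> fin_cases j <;> simp
      j_mul_i := by ext i j; fin_cases i <;> fin_cases j <;> simp; all_goals ring }
  have := quaternionAlgebra_isSimpleRing hk a c
  have hinj : Function.Injective B.liftHom := B.liftHom.toRingHom.injective
  have hbij : Function.Bijective B.liftHom := by
    refine ⟨hinj, ?_⟩
    refine (LinearMap.injective_iff_surjective_of_finrank_eq_finrank
      (f := B.liftHom.toLinearMap) ?_).mp hinj
    simp [QuaternionAlgebra.finrank_eq_four, Module.finrank_matrix]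
  refine Quotient.sound ⟨1, 2, one_ne_zero, two_ne_zero, ⟨?_⟩⟩
  let e : Matrix (Fin 1) (Fin 1) (QuaternionAlgebra k (a : k) 0 (c : k)) ≃ₐ[k]
      QuaternionAlgebra k (a : k) 0 (c : k) := by
    -- `convert` reconciles the `Fintype` and `DecidableEq` instances on `Fin 1`
    convert Matrix.uniqueAlgEquiv (m := Fin 1) (R := k)
      (A := QuaternionAlgebra k (a : k) 0 (c : k))
  exact e.trans (AlgEquiv.ofBijective B.liftHom hbij)

/-! ### The group generated by sign changes -/

open IntermediateField

theorem isGalois_of_adjoin_sqrt {M E : Type*} [Field M] [Field E] [Algebra M E] (h2 : (2 : M) ≠ 0)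
    {ι : Type*} {a : ι → M} (ha : ∀ i, a i ≠ 0) {β : ι → E}
    (hβ : ∀ i, β i ^ 2 = algebraMap M E (a i)) (htop : adjoin M (Set.range β) = ⊤) :
    IsGalois M E := by
  have hroot : ∀ i, Polynomial.aeval (β i) (.X ^ 2 - .C (a i) : Polynomial M) = 0 := by
    intro i; simp [hβ]
  have hmonic : ∀ i, (.X ^ 2 - .C (a i) : Polynomial M).Monic := fun i =>
    Polynomial.monic_X_pow_sub_C _ two_ne_zero
  have hint : ∀ i, IsIntegral M (β i) := fun i => ⟨_, hmonic i, hroot i⟩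
  have hsep : Algebra.IsSeparable M (adjoin M (Set.range β)) := by
    rw [isSeparable_adjoin_iff_isSeparable]
    rintro _ ⟨i, rfl⟩
    exact (Polynomial.separable_X_pow_sub_C (a i) (by exact_mod_cast h2) (ha i)).of_dvd
      (minpoly.dvd _ _ (hroot i))
  have hsplit : ∀ x ∈ Set.range β,
      IsIntegral M x ∧ ((minpoly M x).map (algebraMap M E)).Splits := by
    rintro _ ⟨i, rfl⟩
    refine ⟨hint i, Polynomial.Splits.of_dvd (f := _)
      (g := (.X ^ 2 - .C (a i) : Polynomial M).map (algebraMap M E)) ?_ ?_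
      (Polynomial.map_dvd _ (minpoly.dvd _ _ (hroot i)))⟩
    · have : (.X ^ 2 - .C (a i) : Polynomial M).map (algebraMap M E) =
          (.X - .C (β i)) * (.X + .C (β i)) := by
        simp only [Polynomial.map_sub, Polynomial.map_pow, Polynomial.map_X, Polynomial.map_C,
          ← hβ, Polynomial.C_pow]
        ring
      rw [this]
      exact (Polynomial.Splits.X_sub_C _).mul (Polynomial.Splits.X_add_C _)
    · exact ((hmonic i).map _).ne_zero
  rw [htop] at hsep
  have hs : Algebra.IsSeparable M E :=
    Algebra.IsSeparable.of_algHom M (⊤ : IntermediateField M E) topEquiv.symm.toAlgHom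
  have hn : Normal M E := by
    refine normal_iff.mpr fun x => ⟨Algebra.IsSeparable.isIntegral M x,
      splits_of_mem_adjoin M E hsplit ?_⟩
    rw [htop]; trivial
  exact { }

/-- Every pattern of signs on the `β j` is realised by a product of the `σ i`. -/
theorem exists_mem_closure_neg_on {k E : Type*} [Field k] [Field E] [Algebra k E] {ι : Type*}
    [DecidableEq ι] {β : ι → E} {σ : ι → (E ≃ₐ[k] E)}
    (hσ : ∀ i j, σ i (β j) = if i = j then -β j else β j) (S : Finset ι) :
    ∃ g ∈ Subgroup.closure (Set.range σ), ∀ j, g (β j) = if j ∈ S then -β j else β j := by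
  induction S using Finset.induction_on with
  | empty => exact ⟨1, one_mem _, by simp⟩
  | insert i S hi ih =>
    obtain ⟨g, hg, hgβ⟩ := ih
    refine ⟨g * σ i, mul_mem hg (Subgroup.subset_closure ⟨i, rfl⟩), fun j => ?_⟩
    rw [AlgEquiv.mul_apply, hσ]
    by_cases hij : i = j
    · subst hij
      simp [hgβ, hi]
    · simp [hij, hgβ, Ne.symm hij]

/-- If the `σ i` fix `S` and the `β j` generate `E` over `k(S)`, then `k(S)` is the whole fixed field:
`E / k(S)` is Galois, and each of its automorphisms changes the signs of some of the `β j`, hence is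
a product of the `σ i`. -/
theorem fixedField_closure_eq {k E : Type*} [Field k] [Field E] [Algebra k E] (h2 : (2 : k) ≠ 0)
    {n : ℕ} {a : Fin n → kˣ} {β : Fin n → E} (hβ : ∀ i, β i ^ 2 = algebraMap k E (a i : k))
    {σ : Fin n → (E ≃ₐ[k] E)} (hσ : ∀ i j, σ i (β j) = if i = j then -β j else β j)
    {S : Set E} (hS : ∀ i, ∀ x ∈ S, σ i x = x)
    (htop : adjoin (adjoin k S) (Set.range β) = ⊤) :
    IsGalois (adjoin k S) E ∧ fixedField (Subgroup.closure (Set.range σ)) = adjoin k S := by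
  set M := adjoin k S
  have hgal : IsGalois M E := by
    refine isGalois_of_adjoin_sqrt (a := fun i => algebraMap k M (a i : k)) ?_ (fun i => ?_)
      (β := β) (fun i => ?_) htop
    · have := (map_ne_zero (algebraMap k M)).mpr h2
      simpa only [map_ofNat] using this
    · simp
    · rw [hβ, ← IsScalarTower.algebraMap_apply]
  have hle : Subgroup.closure (Set.range σ) ≤ M.fixingSubgroup := by
    rw [Subgroup.closure_le]
    rintro _ ⟨i, rfl⟩
    have hle' : M ≤ fixedField (Subgroup.zpowers (σ i)) := by
      rw [adjoin_le_iff]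
      intro x hx
      have hfix : Subgroup.zpowers (σ i) ≤ MulAction.stabilizer (E ≃ₐ[k] E) x := by
        rw [Subgroup.zpowers_le]
        exact hS i x hx
      exact fun g => hfix g.2
    exact (le_iff_le _ _).mp hle' (Subgroup.mem_zpowers _)
  refine ⟨hgal, le_antisymm (fun x hx => ?_) ?_⟩
  · suffices x ∈ Set.range (algebraMap M E) by
      obtain ⟨y, rfl⟩ := this
      exact y.2
    refine (InfiniteGalois.mem_range_algebraMap_iff_fixed x).mpr fun f => ?_
    classical
    obtain ⟨g, hg, hgβ⟩ := exists_mem_closure_neg_on hσ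
      (Finset.univ.filter fun i => f (β i) = -β i)
    let g' : E ≃ₐ[M] E := fixingSubgroupEquiv M ⟨g, hle hg⟩
    have hfg : f = g' := by
      have hon : ∀ i, f (β i) = g' (β i) := by
        intro i
        change _ = g (β i)
        rw [hgβ]
        have hsq : f (β i) ^ 2 = β i ^ 2 := by
          rw [← map_pow, hβ, IsScalarTower.algebraMap_apply k M E, f.commutes]
        rcases sq_eq_sq_iff_eq_or_eq_neg.mp hsq with h | h
        · by_cases h' : f (β i) = -β i <;> simp [h']
          rw [h]
        · simp [h]
      ext x
      have hx : x ∈ adjoin M (Set.range β) := htop ▸ mem_top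
      induction hx using adjoin_induction with
      | mem x hx => obtain ⟨i, rfl⟩ := hx; exact hon i
      | algebraMap x => exact (f.commutes x).trans (g'.commutes x).symm
      | add x y _ _ hx hy => simp [hx, hy]
      | inv x _ hx => simp [hx]
      | mul x y _ _ hx hy => simp [hx, hy]
    rw [hfg]
    exact (mem_fixedField_iff _ _).mp hx g hg
  · exact (le_iff_le _ _).mpr hle

/-! ### Generators and transcendence degree of rational function fields -/

theorem ratFunVar_ne_algebraMap {n : ℕ} {K : Type*} [Field K] (i : Fin n) (z : K) :
    ratFunVar K i ≠ algebraMap K (RatFunField n K) z := by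
  intro h
  rw [IsScalarTower.algebraMap_apply K (MvPolynomial (Fin n) K)] at h
  have h' := IsFractionRing.injective (MvPolynomial (Fin n) K) (RatFunField n K) h
  have := congrArg MvPolynomial.totalDegree h'
  simp [MvPolynomial.totalDegree_X] at this

/-- `K(x₁, …, xₙ)` is generated over `M` by the square roots as soon as these yield every `xᵢ`. -/
theorem adjoin_sqrt_eq_top {k K : Type*} [Field k] [Field K] [Algebra k K] {n : ℕ}
    {α : Fin n → K} (hK : adjoin k (Set.range α) = ⊤)
    (M : IntermediateField k (RatFunField n K))
    (hx : ∀ i, ratFunVar K i ∈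
      adjoin M (Set.range fun j => algebraMap K (RatFunField n K) (α j))) :
    adjoin M (Set.range fun j => algebraMap K (RatFunField n K) (α j)) = ⊤ := by
  set F := adjoin M (Set.range fun j => algebraMap K (RatFunField n K) (α j)) with hF
  have hconst : ∀ z : K, algebraMap K (RatFunField n K) z ∈ F := by
    have : adjoin k (Set.range α) ≤
        (F.restrictScalars k).comap (IsScalarTower.toAlgHom k K (RatFunField n K)) := by
      rw [adjoin_le_iff]
      rintro _ ⟨i, rfl⟩
      exact subset_adjoin M _ ⟨i, rfl⟩
    rw [hK] at this
    exact fun z => this (mem_top (x := z))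
  have hpoly : ∀ f : MvPolynomial (Fin n) K,
      algebraMap (MvPolynomial (Fin n) K) (RatFunField n K) f ∈ F := by
    intro f
    induction f using MvPolynomial.induction_on with
    | C z =>
      rw [← MvPolynomial.algebraMap_eq, ← IsScalarTower.algebraMap_apply]
      exact hconst z
    | add f g hf hg => rw [map_add]; exact add_mem hf hg
    | mul_X f i hf => rw [map_mul]; exact mul_mem hf (hx i)
  refine eq_top_iff.mpr fun y _ => ?_
  obtain ⟨f, g, -, rfl⟩ := IsFractionRing.div_surjective (MvPolynomial (Fin n) K) y
  exact div_mem (hpoly f) (hpoly g)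

/-- Exactly `n` elements over which `K(x₁, …, xₙ)` is algebraic must be algebraically independent, since
the transcendence degree over `k` is at least `n`. -/
theorem algebraicIndependent_of_isAlgebraic_adjoin {k K : Type*} [Field k] [Field K] [Algebra k K]
    {n : ℕ} (w : Fin n → RatFunField n K)
    [h : Algebra.IsAlgebraic (adjoin k (Set.range w)) (RatFunField n K)] :
    AlgebraicIndependent k w := by
  have hX : AlgebraicIndependent K (ratFunVar K : Fin n → RatFunField n K) :=
    (MvPolynomial.algebraicIndependent_X (Fin n) K).map'
      (f := IsScalarTower.toAlgHom K (MvPolynomial (Fin n) K) (RatFunField n K))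
      (IsFractionRing.injective _ _)
  have hcard := (hX.restrictScalars (algebraMap k K).injective).lift_cardinalMk_le_trdeg
  have := isAlgebraic_adjoin_iff_top.mp h
  exact (Algebra.IsAlgebraic.isTranscendenceBasis_of_lift_le_trdeg_of_finite k w hcard).1

theorem isRationalOver_of_fixedField_eq {k K : Type*} [Field k] [Field K] [Algebra k K] {n : ℕ}
    {L : IntermediateField k (RatFunField n K)} (w : Fin n → RatFunField n K)
    (hL : L = adjoin k (Set.range w))
    [Algebra.IsAlgebraic (adjoin k (Set.range w)) (RatFunField n K)] :
    IsRationalOver k L := by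
  subst hL
  exact ⟨n, ⟨(algebraicIndependent_of_isAlgebraic_adjoin w).aevalEquivField.symm⟩⟩

/-- No variables need be adjoined: `L` is the fraction field of `L[∅]`. -/
theorem IsRationalOver.isStablyRationalOver {k L : Type*} [Field k] [Field L] [Algebra k L]
    (h : IsRationalOver k L) : IsStablyRationalOver k L := by
  obtain ⟨m, ⟨e⟩⟩ := h
  let e₀ : L ≃ₐ[L] MvPolynomial (Fin 0) L := (MvPolynomial.isEmptyAlgEquiv L (Fin 0)).symm
  have hbij : Function.Bijective
      (algebraMap (MvPolynomial (Fin 0) L) (FractionRing (MvPolynomial (Fin 0) L))) :=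
    (e₀.symm.toMulEquiv.isField (Field.toIsField L)).localization_map_bijective
      (M := nonZeroDivisors (MvPolynomial (Fin 0) L)) (by simp)
  let e₁ := AlgEquiv.ofBijective
    (IsScalarTower.toAlgHom L (MvPolynomial (Fin 0) L)
      (FractionRing (MvPolynomial (Fin 0) L))) hbij
  exact ⟨0, m, ⟨((e₀.trans e₁).restrictScalars k).symm.trans e⟩⟩

theorem IsStablyRationalOver.isUnirationalOver {k L : Type*} [Field k] [Field L] [Algebra k L]
    (h : IsStablyRationalOver k L) : IsUnirationalOver k L := by
  obtain ⟨m, m', ⟨e⟩⟩ := h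
  exact ⟨m', ⟨e.toAlgHom.comp (IsScalarTower.toAlgHom k L _)⟩⟩

/-! ### The conic `s² - a t² = c` with a rational point -/

section Conic

variable {k E : Type*} [Field k] [Field E] [Algebra k E] {a c : k} {β x : E}

/-- If `p² - a q² = c`, then `c` is the norm of `p + q√a`. -/
theorem norm_factor (hβ : β ^ 2 = algebraMap k E a) {p q : k} (hpq : p ^ 2 - a * q ^ 2 = c) :
    (algebraMap k E p + β * algebraMap k E q) * (algebraMap k E p - β * algebraMap k E q) =
      algebraMap k E c := by
  rw [← hpq, map_sub, map_mul, map_pow, map_pow, ← hβ]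
  ring

/-- The element `√a (θ + x) / (θ - x)`, where `θ = p + q√a` and `β = √a`. When `θ` has norm `c`, the
quotient `z = x / θ` is inverted by `√a ↦ -√a`, `x ↦ c / x`, so `√a (1 + z) / (1 - z)` is invariant.
In terms of `x = s + √a t` this is `-(s + p) / (t - q)`, the projection of the conic
`s² - a t² = c` from its point `(-p, q)` up to sign. -/
noncomputable def conicParameter (β x : E) (p q : k) : E :=
  β * (algebraMap k E p + β * algebraMap k E q + x) /
    (algebraMap k E p + β * algebraMap k E q - x)

theorem map_conicParameter_of_fixed {σ : E ≃ₐ[k] E} (hσβ : σ β = β) (hσx : σ x = x) (p q : k) :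
    σ (conicParameter β x p q) = conicParameter β x p q := by
  simp only [conicParameter, map_div₀, map_mul, map_add, map_sub, AlgEquiv.commutes, hσβ, hσx]

theorem map_conicParameter_of_neg (hβ : β ^ 2 = algebraMap k E a) {p q : k}
    (hpq : p ^ 2 - a * q ^ 2 = c) (hx : x ≠ 0)
    (hne : algebraMap k E p + β * algebraMap k E q - x ≠ 0)
    {σ : E ≃ₐ[k] E} (hσβ : σ β = -β) (hσx : σ x = algebraMap k E c / x) :
    σ (conicParameter β x p q) = conicParameter β x p q := by
  have hne' : algebraMap k E p + -β * algebraMap k E q - algebraMap k E c / x ≠ 0 := by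
    have h := (map_ne_zero σ).mpr hne
    simpa only [map_sub, map_add, map_mul, AlgEquiv.commutes, hσβ, hσx] using h
  simp only [conicParameter, map_div₀, map_mul, map_add, map_sub, AlgEquiv.commutes, hσβ, hσx]
  rw [div_eq_div_iff hne' hne, ← norm_factor hβ hpq]
  field_simp
  ring

/-- The parameter determines `x`, by inverting a Möbius transformation. -/
theorem eq_div_conicParameter (h2 : (2 : k) ≠ 0) (ha : a ≠ 0) (hc : c ≠ 0)
    (hβ : β ^ 2 = algebraMap k E a) {p q : k} (hpq : p ^ 2 - a * q ^ 2 = c)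
    (hne : algebraMap k E p + β * algebraMap k E q - x ≠ 0) :
    x = (algebraMap k E p + β * algebraMap k E q) * (conicParameter β x p q - β) /
      (conicParameter β x p q + β) := by
  have h2E : (2 : E) ≠ 0 := by
    simpa only [map_ofNat] using (map_ne_zero (algebraMap k E)).mpr h2
  have hβ0 : β ≠ 0 := by
    rintro rfl
    exact ha (by simpa using hβ.symm)
  have hθ : algebraMap k E p + β * algebraMap k E q ≠ 0 := by
    refine left_ne_zero_of_mul (b := algebraMap k E p - β * algebraMap k E q) ?_
    rw [norm_factor hβ hpq]
    simpa using hc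
  set θ := algebraMap k E p + β * algebraMap k E q with hθdef
  have hw : conicParameter β x p q = β * (θ + x) / (θ - x) := rfl
  have hsum : conicParameter β x p q + β = 2 * β * θ / (θ - x) := by
    rw [hw]; field_simp; ring
  have hdiff : conicParameter β x p q - β = 2 * β * x / (θ - x) := by
    rw [hw]; field_simp; ring
  rw [hsum, hdiff]
  field_simp

end Conic

/-! ### The fixed field -/

section FixedField

variable {k : Type u} {K : Type v} [Field k] [Field K] [Algebra k K] {n : ℕ} {a c : Fin n → kˣ}
  {α : Fin n → K} {σ : Fin n → (RatFunField n K ≃ₐ[k] RatFunField n K)}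

/-- From a rational point one obtains `n` invariant elements that generate the fixed field, which are
algebraically independent because there are only `n` of them. -/
theorem isRationalOver_of_exists_point (h2 : (2 : k) ≠ 0)
    (hα : ∀ i, α i ^ 2 = algebraMap k K (a i : k)) (hK : adjoin k (Set.range α) = ⊤)
    (hσα : ∀ i j, σ i (algebraMap K (RatFunField n K) (α j)) =
      if i = j then -algebraMap K (RatFunField n K) (α j)
      else algebraMap K (RatFunField n K) (α j))
    (hσx : ∀ i j, σ i (ratFunVar K j) =
      if i = j then algebraMap k (RatFunField n K) (c j : k) / ratFunVar K j
      else ratFunVar K j)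
    {p q : Fin n → k} (hpq : ∀ i, p i ^ 2 - (a i : k) * q i ^ 2 = (c i : k)) :
    IsRationalOver k (fixedField (Subgroup.closure (Set.range σ))) := by
  have hβ : ∀ i, (algebraMap K (RatFunField n K) (α i)) ^ 2 =
      algebraMap k (RatFunField n K) (a i : k) := fun i => by
    rw [← map_pow, hα, ← IsScalarTower.algebraMap_apply]
  have hne : ∀ i, algebraMap k (RatFunField n K) (p i) +
      algebraMap K (RatFunField n K) (α i) * algebraMap k (RatFunField n K) (q i) -
        ratFunVar K i ≠ 0 := fun i h =>
    ratFunVar_ne_algebraMap i (algebraMap k K (p i) + α i * algebraMap k K (q i)) <| by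
      rw [← sub_eq_zero.mp h, map_add, map_mul, ← IsScalarTower.algebraMap_apply,
        ← IsScalarTower.algebraMap_apply]
  let w : Fin n → RatFunField n K := fun i =>
    conicParameter (algebraMap K (RatFunField n K) (α i)) (ratFunVar K i) (p i) (q i)
  have hσw : ∀ i, ∀ y ∈ Set.range w, σ i y = y := by
    rintro i _ ⟨j, rfl⟩
    have hσβ := hσα i j
    have hσX := hσx i j
    by_cases hij : i = j
    · subst hij
      rw [if_pos rfl] at hσβ hσX
      exact map_conicParameter_of_neg (hβ i) (hpq i)
        (by simpa using ratFunVar_ne_algebraMap i (0 : K)) (hne i) hσβ hσX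
    · rw [if_neg hij] at hσβ hσX
      exact map_conicParameter_of_fixed hσβ hσX _ _
  obtain ⟨hgal, hfix⟩ := fixedField_closure_eq h2 hβ hσα hσw <| by
    refine adjoin_sqrt_eq_top hK _ fun i => ?_
    set F := adjoin (adjoin k (Set.range w))
      (Set.range fun j => algebraMap K (RatFunField n K) (α j))
    have hβF : algebraMap K (RatFunField n K) (α i) ∈ F := subset_adjoin _ _ ⟨i, rfl⟩
    have hkF : ∀ y : k, algebraMap k (RatFunField n K) y ∈ F := (F.restrictScalars k).algebraMap_mem
    have hwF : w i ∈ F := F.algebraMap_mem ⟨w i, subset_adjoin k _ ⟨i, rfl⟩⟩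
    rw [eq_div_conicParameter h2 (a i).ne_zero (c i).ne_zero (hβ i) (hpq i) (hne i)]
    exact div_mem (mul_mem (add_mem (hkF _) (mul_mem hβF (hkF _))) (sub_mem hwF hβF))
      (add_mem hwF hβF)
  exact isRationalOver_of_fixedField_eq w hfix

/-- The generators are characterised by `x = s + √a t` and `c / x = s - √a t`. -/
theorem exists_fixedField_eq_adjoin (h2 : (2 : k) ≠ 0)
    (hα : ∀ i, α i ^ 2 = algebraMap k K (a i : k)) (hK : adjoin k (Set.range α) = ⊤)
    (hσα : ∀ i j, σ i (algebraMap K (RatFunField n K) (α j)) =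
      if i = j then -algebraMap K (RatFunField n K) (α j)
      else algebraMap K (RatFunField n K) (α j))
    (hσx : ∀ i j, σ i (ratFunVar K j) =
      if i = j then algebraMap k (RatFunField n K) (c j : k) / ratFunVar K j
      else ratFunVar K j) :
    ∃ s t : Fin n → RatFunField n K,
      fixedField (Subgroup.closure (Set.range σ)) = adjoin k (Set.range s ∪ Set.range t) ∧
      ∀ i, s i ^ 2 - algebraMap k (RatFunField n K) (a i : k) * t i ^ 2 =
        algebraMap k (RatFunField n K) (c i : k) := by
  have hβ : ∀ i, (algebraMap K (RatFunField n K) (α i)) ^ 2 =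
      algebraMap k (RatFunField n K) (a i : k) := fun i => by
    rw [← map_pow, hα, ← IsScalarTower.algebraMap_apply]
  have h2E : (2 : RatFunField n K) ≠ 0 := by
    simpa only [map_ofNat] using (map_ne_zero (algebraMap k (RatFunField n K))).mpr h2
  have hx0 : ∀ i, (ratFunVar K i : RatFunField n K) ≠ 0 := fun i => by
    simpa using ratFunVar_ne_algebraMap i (0 : K)
  have hc0 : ∀ i, algebraMap k (RatFunField n K) (c i : k) ≠ 0 := fun i => by simp
  have hβ0 : ∀ i, algebraMap K (RatFunField n K) (α i) ≠ 0 := fun i h =>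
    (a i).ne_zero <| by simpa [h] using (hβ i).symm
  let s : Fin n → RatFunField n K := fun i =>
    (ratFunVar K i + algebraMap k (RatFunField n K) (c i : k) / ratFunVar K i) / 2
  let t : Fin n → RatFunField n K := fun i =>
    (ratFunVar K i - algebraMap k (RatFunField n K) (c i : k) / ratFunVar K i) /
      (2 * algebraMap K (RatFunField n K) (α i))
  have hst : ∀ i, ratFunVar K i = s i + algebraMap K (RatFunField n K) (α i) * t i := fun i => by
    have := hx0 i
    have := hβ0 i
    simp only [s, t]
    field_simp
    ring
  refine ⟨s, t, (fixedField_closure_eq h2 hβ hσα ?_ ?_).2, fun i => ?_⟩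
  · rintro i _ (⟨j, rfl⟩ | ⟨j, rfl⟩)
    all_goals
      have hσβ := hσα i j
      have hσX := hσx i j
      have := hx0 j
      have := hc0 j
      have := hβ0 j
      by_cases hij : i = j
      · subst hij
        rw [if_pos rfl] at hσβ hσX
        simp only [s, t, map_div₀, map_mul, map_add, map_sub, AlgEquiv.commutes, map_ofNat, hσβ,
          hσX]
        field_simp
        ring
      · rw [if_neg hij] at hσβ hσX
        simp only [s, t, map_div₀, map_mul, map_add, map_sub, AlgEquiv.commutes, map_ofNat, hσβ,
          hσX]
  · refine adjoin_sqrt_eq_top hK _ fun i => ?_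
    rw [hst]
    refine add_mem ?_ (mul_mem (subset_adjoin _ _ ⟨i, rfl⟩) ?_)
    · exact IntermediateField.algebraMap_mem _ (⟨s i, subset_adjoin k _ (Or.inl ⟨i, rfl⟩)⟩ :
        adjoin k (Set.range s ∪ Set.range t))
    · exact IntermediateField.algebraMap_mem _ (⟨t i, subset_adjoin k _ (Or.inr ⟨i, rfl⟩)⟩ :
        adjoin k (Set.range s ∪ Set.range t))
  · have := hx0 i
    have := hβ0 i
    rw [← hβ]
    simp only [s, t]
    field_simp
    ring

end FixedField

theorem theorem2p12 {k : Type u} {K : Type v} [Field k] [Field K] [Algebra k K]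
    (hk : ringChar k ≠ 2) (n : ℕ) (a c : Fin n → kˣ)
    -- `α i` is the chosen square root of `a i` in `K`, and `K = k(α 1, …, α n)`
    (α : Fin n → K) (hα : ∀ i, α i ^ 2 = algebraMap k K (a i : k))
    (hK : IntermediateField.adjoin k (Set.range α) = ⊤)
    (σ : Fin n → (RatFunField n K ≃ₐ[k] RatFunField n K))
    (hσα : ∀ i j, σ i (algebraMap K (RatFunField n K) (α j)) =
      if i = j then -algebraMap K (RatFunField n K) (α j)
      else algebraMap K (RatFunField n K) (α j))
    (hσx : ∀ i j, σ i (ratFunVar K j) =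
      if i = j then algebraMap k (RatFunField n K) (c j : k) / ratFunVar K j
      else ratFunVar K j) :
    (∃ s t : Fin n → RatFunField n K,
      IntermediateField.fixedField (Subgroup.closure (Set.range σ)) =
        IntermediateField.adjoin k (Set.range s ∪ Set.range t) ∧
      ∀ i, s i ^ 2 - algebraMap k (RatFunField n K) (a i : k) * t i ^ 2 =
        algebraMap k (RatFunField n K) (c i : k)) ∧
    List.TFAE [
      IsRationalOver k (IntermediateField.fixedField (Subgroup.closure (Set.range σ))),
      IsStablyRationalOver k (IntermediateField.fixedField (Subgroup.closure (Set.range σ))),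
      IsUnirationalOver k (IntermediateField.fixedField (Subgroup.closure (Set.range σ))),
      ∃ p q : Fin n → k, ∀ i, p i ^ 2 - (a i : k) * q i ^ 2 = (c i : k),
      ∀ i, normResidueSymbolTwo hk (a i) (c i) = 0] := by
  have h2 : (2 : k) ≠ 0 := Ring.two_ne_zero hk
  have hgen := exists_fixedField_eq_adjoin h2 hα hK hσα hσx
  refine ⟨hgen, ?_⟩
  tfae_have 1 → 2 := IsRationalOver.isStablyRationalOver
  tfae_have 2 → 3 := IsStablyRationalOver.isUnirationalOver
  tfae_have 3 → 4 := by
    rintro ⟨m, ⟨φ⟩⟩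
    obtain ⟨s, t, hL, hst⟩ := hgen
    have hs : ∀ i, s i ∈ fixedField (Subgroup.closure (Set.range σ)) := fun i =>
      hL ▸ subset_adjoin k _ (Or.inl ⟨i, rfl⟩)
    have ht : ∀ i, t i ∈ fixedField (Subgroup.closure (Set.range σ)) := fun i =>
      hL ▸ subset_adjoin k _ (Or.inr ⟨i, rfl⟩)
    have hpt : ∀ i, ∃ p q : k, p ^ 2 - (a i : k) * q ^ 2 = (c i : k) := fun i => by
      refine exists_sq_sub_mul_sq_eq_of_fractionRing hk (a i).ne_zero (s := φ ⟨s i, hs i⟩)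
        (t := φ ⟨t i, ht i⟩) ?_
      rw [← φ.commutes, ← φ.commutes, ← map_pow, ← map_pow, ← map_mul, ← map_sub]
      exact congrArg φ (Subtype.ext (hst i))
    choose p q hpq using hpt
    exact ⟨p, q, hpq⟩
  tfae_have 4 → 1 := fun ⟨_, _, hpq⟩ => isRationalOver_of_exists_point h2 hα hK hσα hσx hpq
  tfae_have 4 → 5 := fun ⟨_, _, hpq⟩ i => normResidueSymbolTwo_eq_zero hk (hpq i)
  tfae_have 5 → 4 := fun h => by
    choose p q hpq using fun i => exists_of_normResidueSymbolTwo_eq_zero hk (h i)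
    exact ⟨p, q, hpq⟩
  tfae_finish
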